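/- **Setting.** Let $K,N\ge 1$ be integers. There are $N$ non-communicating databases, each storing the same $K$ independent messages $W_1,\dots,W_K\in\{0,1\}^L$ with $H(W_k)=L$ (entropies in bits). A *scheme with partially known uncoded prefetching* with message length $L$ and prefetching size $c$ consists of random variables (queries and answers in countable alphabets) as follows. For each database $n\in[N]$, $\mathbb H_n$ is a random set of bit positions of the messages containing exactly $c$ positions of each message, with $\mathbb H_1,\dots,\mathbb H_N$ pairwise disjoint; their joint law is otherwise arbitrary and does not depend on the desired message. The user caches the bits $Z_n$ at the positions $\mathbb H_n$; write $Z=(Z_1,\dots,Z_N)$, $\mathbb H=(\mathbb H_1,\dots,\mathbb H_N)$. For each desired index $\theta\in[K]$ there are queries $Q_n^{[\theta]}$ and answers $A_n^{[\theta]}$, $n\in[N]$, such that - $(\mathbb H,Q_1^{[\theta]},\dots,Q_N^{[\theta]})$ is independent of $(W_1,\dots,W_K)$; - (privacy) $(Q_n^{[\theta]},A_n^{[\theta]},W_1,\dots,W_K,\mathbb H_n)\sim(Q_n^{[\theta']},A_n^{[\theta']},W_1,\dots,W_K,\mathbb H_n)$ for all $n\in[N]$ and $\theta,\theta'\in[K]$,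 where $\sim$ means identically distributed; - $H(A_n^{[\theta]}\mid Q_n^{[\theta]},W_1,\dots,W_K)=0$ for all $n,\theta$. Its download cost is $D=\sum_{n=1}^N H(A_n^{[\theta]})$, which by privacy does not depend on $\theta$. For $0\le r\le 1$, a number $d\in[0,\infty]$ is *achievable at caching ratio $r$* if there is a sequence of such schemes (with the given $K,N$) with $L\to\infty$, $Nc/L\to r$, $H(W_\theta\mid Z,\mathbb H,Q_{1}^{[\theta]},\dots,Q_N^{[\theta]},A_{1}^{[\theta]},\dots,A_N^{[\theta]})=o(L)$ for every $\theta\in[K]$, and $D/L\to d$. The optimal normalized download cost $D^*(r)$ is the infimum of all $d$ achievable at caching ratio $r$. **Theorem 2 (Inner bound).** For all integers $K,N\ge1$ and all real $r\in[0,1]$, $$D^*(r)\;\ge\;\max_{i\in\{2,\dots,K+1\}}\left[(1-r)\sum_{j=0}^{K+1-i}\frac1{N^j}-r\Bigl(1-\frac1N\Bigr)\sum_{j=0}^{K-i}\frac{K+1-i-j}{N^j}\right]=\max_{i\in\{2,\dots,K+1\}}\left[\sum_{j=0}^{K+1-i}\frac1{N^j}-(K+2-i)\,r\right],$$ where an empty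 sum is $0$. -/

import Mathlib

open MeasureTheory ProbabilityTheory Filter Topology
open scoped ENNReal

noncomputable section

namespace CachePIR

/-- The Shannon entropy, in bits, of a random variable `X` with values in a countable alphabet:
`H(X) = - ∑ x, P(X = x) log₂ P(X = x)`, a value in `[0, ∞]`. -/
def entropy {Ω α : Type} [MeasurableSpace Ω] (μ : Measure Ω) (X : Ω → α) : ℝ≥0∞ :=
  ∑' x : α, ENNReal.ofReal (Real.negMulLog (μ.real (X ⁻¹' {x})) / Real.log 2)

/-- The conditional Shannon entropy, in bits, of `X` given `Y` (both with countable alphabets):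
`H(X | Y) = ∑ y, P(Y = y) H(X | Y = y)`. -/
def condEntropy {Ω α β : Type} [MeasurableSpace Ω] (μ : Measure Ω) (X : Ω → α) (Y : Ω → β) :
    ℝ≥0∞ :=
  ∑' y : β, μ (Y ⁻¹' {y}) * entropy (μ[|Y ⁻¹' {y}]) X

/-- The uncoded cache content that belongs to a family `h` of index sets (`h k` is the set of
cached positions of message `k`) and to messages `w`: the bit of `w k` at each cached position,
and `none` at the other positions. -/
def cacheContent {K L : ℕ} (h : Fin K → Finset (Fin L)) (w : Fin K → Fin L → Bool) :
    Fin K → Fin L → Option Bool :=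
  fun k l => if l ∈ h k then some (w k l) else none

/-- A private information retrieval scheme with partially known uncoded prefetching, for `K`
messages and `N` replicated, non-colluding databases. The index `θ` of the desired message is a
parameter: `Q θ n` and `A θ n` are the query to and the answer of database `n` when message `θ` is
desired. The messages and the cached positions carry no `θ`, since prefetching takes place before
`θ` is chosen. -/
structure Scheme (K N : ℕ) where
  /-- The message length in bits. -/
  L : ℕ
  /-- The number of bits of each message that are prefetched from each database, so that the user
  caches `N * c` of the `L` bits of every message. -/
  c : ℕ
  /-- The underlying probability space. -/
  Ω : Type
  [mΩ : MeasurableSpace Ω]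
  /-- The underlying probability measure. -/
  μ : Measure Ω
  [prob : IsProbabilityMeasure μ]
  /-- The alphabet of the queries. -/
  Query : Type
  [mQuery : MeasurableSpace Query]
  [singletonQuery : MeasurableSingletonClass Query]
  [countableQuery : Countable Query]
  /-- The alphabet of the answering strings. -/
  Answer : Type
  [mAnswer : MeasurableSpace Answer]
  [singletonAnswer : MeasurableSingletonClass Answer]
  [countableAnswer : Countable Answer]
  /-- The messages. -/
  W : Fin K → Ω → (Fin L → Bool)
  /-- `cached n ω k` is the set of positions of message `k` that are prefetched from
  database `n`. -/
  cached : Fin N → Ω → (Fin K → Finset (Fin L))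
  /-- The queries. -/
  Q : Fin K → Fin N → Ω → Query
  /-- The answering strings. -/
  A : Fin K → Fin N → Ω → Answer
  measurable_W : ∀ k, Measurable (W k)
  measurable_cached : ∀ n, Measurable (cached n)
  measurable_Q : ∀ θ n, Measurable (Q θ n)
  measurable_A : ∀ θ n, Measurable (A θ n)
  /-- Each message has entropy `L`. -/
  entropy_W : ∀ k, entropy μ (W k) = L
  /-- The messages are independent. -/
  indep_W : iIndepFun W μ
  /-- From each database the same number `c` of bits of each message is prefetched. -/
  card_cached : ∀ n ω k, (cached n ω k).card = c
  /-- Different databases provide different bits. -/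
  disjoint_cached : ∀ n n', n ≠ n' → ∀ ω k, Disjoint (cached n ω k) (cached n' ω k)
  /-- The cached positions, and the queries, which are generated from them and from private
  randomness of the user, are independent of the contents of the messages. -/
  indep_query : ∀ θ, IndepFun (fun ω k => W k ω) (fun ω => (fun n => cached n ω, fun n => Q θ n ω)) μ
  /-- Privacy: what database `n` knows (its query, its answer, the messages, and the positions that
  it has provided) has the same distribution for every desired message. -/
  privacy : ∀ n θ θ',
    IdentDistrib (fun ω => (Q θ n ω, A θ n ω, (fun k => W k ω), cached n ω))
      (fun ω => (Q θ' n ω, A θ' n ω, (fun k => W k ω), cached n ω)) μ μ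
  /-- The answer of a database is determined by its query and the messages. -/
  answer : ∀ θ n, condEntropy μ (A θ n) (fun ω => (Q θ n ω, fun k => W k ω)) = 0

attribute [instance] Scheme.mΩ Scheme.prob Scheme.mQuery Scheme.singletonQuery
  Scheme.countableQuery Scheme.mAnswer Scheme.singletonAnswer Scheme.countableAnswer

namespace Scheme

variable {K N : ℕ}

/-- The bits `Z n` that are prefetched from database `n`. -/
def Z (S : Scheme K N) (n : Fin N) (ω : S.Ω) : Fin K → Fin S.L → Option Bool :=
  cacheContent (S.cached n ω) (fun k => S.W k ω)

/-- The remaining uncertainty `H(W_θ | Z, ℍ, Q_{1:N}^{[θ]}, A_{1:N}^{[θ]})` of the user about the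
desired message `θ` after the retrieval phase. -/
def residual (S : Scheme K N) (θ : Fin K) : ℝ≥0∞ :=
  condEntropy S.μ (S.W θ)
    (fun ω => (fun n => S.Z n ω, fun n => S.cached n ω, fun n => S.Q θ n ω, fun n => S.A θ n ω))

/-- The download cost `∑ n, H(A_n^{[θ]})`. -/
def downloadCost (S : Scheme K N) (θ : Fin K) : ℝ≥0∞ :=
  ∑ n, entropy S.μ (S.A θ n)

end Scheme

/-- The normalized download cost `d` is achievable at caching ratio `r`: there are schemes
`S 0, S 1, …` with message lengths tending to infinity, with caching ratios `N c / L` tending to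
`r`, which are reliable, i.e. the remaining uncertainty about the desired message is `o(L)`, and
whose normalized download costs `D / L` tend to `d`. -/
def Achievable (K N : ℕ) (r : ℝ) (d : ℝ≥0∞) : Prop :=
  ∃ S : ℕ → Scheme K N,
    Tendsto (fun m => (S m).L) atTop atTop ∧
    Tendsto (fun m => ((N * (S m).c : ℕ) : ℝ) / ((S m).L : ℝ)) atTop (𝓝 r) ∧
    (∀ θ, Tendsto (fun m => (S m).residual θ / ((S m).L : ℝ≥0∞)) atTop (𝓝 0)) ∧
    ∀ θ, Tendsto (fun m => (S m).downloadCost θ / ((S m).L : ℝ≥0∞)) atTop (𝓝 d)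

/-- The optimal normalized download cost `D*(r)`. -/
def optimalCost (K N : ℕ) (r : ℝ) : ℝ≥0∞ :=
  sInf {d | Achievable K N r d}

end CachePIR

end

/-!
The bound is the classical converse of private information retrieval, applied to the scheme in
which the answer of database `n` is the pair `(A_n, Z_n)` of its answer and the bits prefetched
from it, and its query is the pair `(Q_n, ℍ_n)`. This scheme is again private, and given its
queries its answers are functions of the messages.

Let `Φ_θ(s) = H(A_{1:N}^{[θ]}, Z | W_s, ℍ, Q_{1:N}^{[θ]})` for a set `s` of messages and `θ ∉ s`.
* The desired message can be decoded, so `Φ_θ(s) ≥ L + Φ_θ(s ∪ {θ}) - o(L)`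
  (`Scheme.message_add_jointEntropy_insert_le`).
* The joint entropy lies between the mean and the sum of the entropies of the single observations
  `(A_n, Z_n)`, and by privacy these do not depend on `θ`; hence `N Φ_θ(s) ≥ Φ_θ'(s)`
  (`Scheme.jointEntropy_le_mul`).
* Alternating these two steps, `Φ_θ(s) ≥ L (1 + 1/N + ⋯ + 1/N ^ m) - o(L)` if `m + 1` messages are
  outside `s` (`Scheme.geometric_le_jointEntropy`).
* On the other hand the answers contribute at most `D` to `Φ_θ(s)`, and the cached bits of the
  `m + 1` messages outside `s` at most `(m + 1) N c` (`Scheme.jointEntropy_le_download`).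

Division by `L` gives `D*(r) ≥ 1 + 1/N + ⋯ + 1/N ^ m - (m + 1) r`, which is the second form of the
bound with `i = K + 1 - m`; `inner_bound_eq` identifies it with the first form.

Since the cached positions and the queries are independent of the messages, every entropy above is
a mean, over positions and queries, of entropies of functions on the finite probability space of
the messages. For these, entropy is a real number and Shannon's inequalities are finite sums
(`finEntropy_submodular`). Only three facts concern general countable
alphabets: an answer without conditional entropy is a function of query and messages
(`exists_ae_eq_of_condEntropy_eq_zero`), conditioning does not increase entropy
(`condEntropy_le_entropy`), and the translation `condEntropy_eq_lintegral`.
-/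

namespace CachePIR

/-! ### Entropy of functions on a finite probability space -/

section FiniteEntropy

variable {V α β γ : Type*} [Fintype V] {p : V → ℝ}

open scoped Classical in
/-- The mass, under the weights `p`, of the fibre of `f` through `w`. -/
noncomputable def fiberMass (p : V → ℝ) (f : V → α) (w : V) : ℝ :=
  ∑ v, if f v = f w then p v else 0

theorem fiberMass_eq_sum [DecidableEq α] (p : V → ℝ) (f : V → α) (w : V) :
    fiberMass p f w = ∑ v, if f v = f w then p v else 0 := by
  unfold fiberMass
  congr!

/-- The entropy, in bits, of the random variable `f` on the finite probability space with weights
`p`, as the expectation of `- log₂` of the probability of the observed value. No sum over the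
alphabet occurs, so that the entropy visibly depends on the fibres of `f` only. -/
noncomputable def finEntropy (p : V → ℝ) (f : V → α) : ℝ :=
  (∑ w, p w * -Real.log (fiberMass p f w)) / Real.log 2

/-- The conditional entropy `H(f | g) = H(f, g) - H(g)` on a finite probability space. -/
noncomputable def finCondEntropy (p : V → ℝ) (f : V → α) (g : V → β) : ℝ :=
  finEntropy p (fun w => (f w, g w)) - finEntropy p g

/-- `p` is a probability vector. -/
structure IsProbVec (p : V → ℝ) : Prop where
  nonneg : ∀ w, 0 ≤ p w
  sum_eq_one : ∑ w, p w = 1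

theorem le_fiberMass (hp : IsProbVec p) (f : V → α) (w : V) : p w ≤ fiberMass p f w := by
  classical
  have := Finset.single_le_sum (f := fun v => if f v = f w then p v else 0)
    (fun v _ => by split_ifs; exacts [hp.nonneg v, le_rfl]) (Finset.mem_univ w)
  simpa [fiberMass] using this

theorem fiberMass_nonneg (hp : IsProbVec p) (f : V → α) (w : V) : 0 ≤ fiberMass p f w :=
  (hp.nonneg w).trans (le_fiberMass hp f w)

theorem fiberMass_le_of_factor (hp : IsProbVec p) {f : V → α} {g : V → β}
    (h : ∀ v w, g v = g w → f v = f w) (w : V) : fiberMass p g w ≤ fiberMass p f w := by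
  classical
  refine Finset.sum_le_sum fun v _ => ?_
  by_cases hg : g v = g w
  · simp [hg, h v w hg]
  · simp only [hg, if_false]
    split_ifs
    exacts [hp.nonneg v, le_rfl]

theorem fiberMass_congr {f : V → α} {v w : V} (h : f v = f w) :
    fiberMass p f v = fiberMass p f w := by
  classical simp only [fiberMass_eq_sum, h]

theorem log_two_pos : 0 < Real.log 2 := Real.log_pos one_lt_two

theorem finEntropy_le_of_factor (hp : IsProbVec p) {f : V → α} {g : V → β}
    (h : ∀ v w, g v = g w → f v = f w) : finEntropy p f ≤ finEntropy p g := by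
  refine div_le_div_of_nonneg_right (Finset.sum_le_sum fun w _ => ?_) log_two_pos.le
  rcases (hp.nonneg w).eq_or_lt with h0 | h0
  · simp [← h0]
  · refine mul_le_mul_of_nonneg_left (neg_le_neg (Real.log_le_log ?_ ?_)) h0.le
    · exact h0.trans_le (le_fiberMass hp g w)
    · exact fiberMass_le_of_factor hp h w

theorem finEntropy_congr (hp : IsProbVec p) {f : V → α} {g : V → β}
    (h : ∀ v w, g v = g w ↔ f v = f w) : finEntropy p f = finEntropy p g :=
  le_antisymm (finEntropy_le_of_factor hp fun v w => (h v w).1)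
    (finEntropy_le_of_factor hp fun v w => (h v w).2)

theorem finEntropy_const (hp : IsProbVec p) (a : α) : finEntropy p (fun _ => a) = 0 := by
  simp [finEntropy, fiberMass, hp.sum_eq_one]

theorem finEntropy_nonneg (hp : IsProbVec p) (f : V → α) : 0 ≤ finEntropy p f := by
  rw [← finEntropy_const hp ()]
  exact finEntropy_le_of_factor hp fun _ _ _ => rfl

theorem finCondEntropy_nonneg (hp : IsProbVec p) (f : V → α) (g : V → β) :
    0 ≤ finCondEntropy p f g :=
  sub_nonneg.2 (finEntropy_le_of_factor hp fun _ _ h => (Prod.ext_iff.1 h).2)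

theorem finCondEntropy_mono (hp : IsProbVec p) {f : V → α} {f' : V → β}
    (h : ∀ v w, f' v = f' w → f v = f w) (g : V → γ) :
    finCondEntropy p f g ≤ finCondEntropy p f' g :=
  sub_le_sub_right (finEntropy_le_of_factor hp fun v w hvw => by
    rw [Prod.ext_iff] at hvw ⊢
    exact ⟨h v w hvw.1, hvw.2⟩) _

theorem finCondEntropy_congr_right (hp : IsProbVec p) (f : V → α) {g : V → β} {g' : V → γ}
    (h : ∀ v w, g' v = g' w ↔ g v = g w) : finCondEntropy p f g = finCondEntropy p f g' := by
  rw [finCondEntropy, finCondEntropy, finEntropy_congr hp h]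
  congr 1
  exact finEntropy_congr hp fun v w => by simp [h]

theorem finCondEntropy_const (hp : IsProbVec p) (f : V → α) (b : β) :
    finCondEntropy p f (fun _ => b) = finEntropy p f := by
  rw [finCondEntropy, finEntropy_const hp, sub_zero]
  exact finEntropy_congr hp fun v w => by simp

/-- Within a fibre the weights divided by the mass of the fibre add up to at most one (to one,
unless the fibre has mass zero). -/
theorem sum_div_fiberMass_le_one [DecidableEq α] (p : V → ℝ) (f : V → α) (a : α) :
    ∑ w, (if f w = a then p w / fiberMass p f w else 0) ≤ 1 := by
  by_cases h : ∃ u, f u = a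
  · obtain ⟨u, rfl⟩ := h
    have : ∀ w, (if f w = f u then p w / fiberMass p f w else 0)
        = (if f w = f u then p w else 0) / fiberMass p f u := by
      intro w
      split_ifs with hw
      · rw [fiberMass_congr hw]
      · simp
    simp_rw [this, ← Finset.sum_div, ← fiberMass_eq_sum]
    exact div_self_le_one _
  · push Not at h
    simp [h]

/-- Submodularity of entropy, `H(f, g, h) + H(h) ≤ H(f, h) + H(g, h)`. By `log x ≤ x - 1` it is
enough to bound the mean of `P(f, h) P(g, h) / (P(f, g, h) P(h))` by one. -/
theorem finEntropy_submodular (hp : IsProbVec p) (f : V → α) (g : V → β) (h : V → γ) :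
    finEntropy p (fun w => (f w, g w, h w)) + finEntropy p h
      ≤ finEntropy p (fun w => (f w, h w)) + finEntropy p (fun w => (g w, h w)) := by
  classical
  set F := fun w => (f w, h w) with hF
  set G := fun w => (g w, h w) with hG
  set J := fun w => (f w, g w, h w) with hJ
  -- Expand the two numerators over pairs `(u, v)`: then `u` fixes `f`, `v` fixes `g`, both fix `h`,
  -- and the sum over `w` runs over one fibre of `J`.
  have key : ∑ w, p w * (fiberMass p F w * fiberMass p G w /
      (fiberMass p J w * fiberMass p h w)) ≤ 1 := by
    have e1 : ∀ w, p w * (fiberMass p F w * fiberMass p G w /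
        (fiberMass p J w * fiberMass p h w)) =
        ∑ u, ∑ v, (if h u = h v then p u * p v / fiberMass p h u else 0) *
          (if J w = (f u, g v, h v) then p w / fiberMass p J w else 0) := by
      intro w
      have : fiberMass p F w * fiberMass p G w = ∑ u, ∑ v,
          (if F u = F w then p u else 0) * (if G v = G w then p v else 0) := by
        rw [fiberMass_eq_sum, fiberMass_eq_sum, Finset.sum_mul_sum]
      rw [this, Finset.sum_div, Finset.mul_sum]
      refine Finset.sum_congr rfl fun u _ => ?_
      rw [Finset.sum_div, Finset.mul_sum]
      refine Finset.sum_congr rfl fun v _ => ?_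
      by_cases hu : F u = F w
      · by_cases hv : G v = G w
        · have hu1 : f u = f w := congrArg Prod.fst hu
          have hu2 : h u = h w := congrArg Prod.snd hu
          have hv1 : g v = g w := congrArg Prod.fst hv
          have hv2 : h v = h w := congrArg Prod.snd hv
          have h1 : h u = h v := hu2.trans hv2.symm
          have h2 : J w = (f u, g v, h v) := by simp [hJ, hu1, hv1, hv2]
          rw [if_pos hu, if_pos hv, if_pos h1, if_pos h2, fiberMass_congr hu2]
          simp only [div_eq_mul_inv, mul_inv]
          ring
        · rw [if_neg hv, mul_zero, zero_div, mul_zero]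
          have h2 : ¬ J w = (f u, g v, h v) := fun h2 => hv (by
            simp only [hJ, Prod.mk.injEq] at h2
            simp [hG, h2.2.1, h2.2.2])
          rw [if_neg h2, mul_zero]
      · rw [if_neg hu, zero_mul, zero_div, mul_zero]
        by_cases h1 : h u = h v
        · have h2 : ¬ J w = (f u, g v, h v) := fun h2 => hu (by
            simp only [hJ, Prod.mk.injEq] at h2
            simp [hF, h2.1, h2.2.2, h1])
          rw [if_neg h2, mul_zero]
        · rw [if_neg h1, zero_mul]
    simp_rw [e1]
    rw [Finset.sum_comm]
    calc ∑ u, ∑ w, ∑ v, (if h u = h v then p u * p v / fiberMass p h u else 0) *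
          (if J w = (f u, g v, h v) then p w / fiberMass p J w else 0)
        = ∑ u, ∑ v, (if h u = h v then p u * p v / fiberMass p h u else 0) *
          ∑ w, (if J w = (f u, g v, h v) then p w / fiberMass p J w else 0) := by
          refine Finset.sum_congr rfl fun u _ => ?_
          rw [Finset.sum_comm]
          exact Finset.sum_congr rfl fun v _ => (Finset.mul_sum _ _ _).symm
      _ ≤ ∑ u, ∑ v, (if h u = h v then p u * p v / fiberMass p h u else 0) := by
          refine Finset.sum_le_sum fun u _ => Finset.sum_le_sum fun v _ => ?_
          refine mul_le_of_le_one_right ?_ (sum_div_fiberMass_le_one p J _)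
          split_ifs
          exacts [div_nonneg (mul_nonneg (hp.nonneg _) (hp.nonneg _)) (fiberMass_nonneg hp _ _),
            le_rfl]
      _ = ∑ u, p u * (fiberMass p h u / fiberMass p h u) := by
          refine Finset.sum_congr rfl fun u _ => ?_
          conv_rhs => rw [fiberMass_eq_sum p h, Finset.sum_div, Finset.mul_sum, ← fiberMass_eq_sum]
          refine Finset.sum_congr rfl fun v _ => ?_
          by_cases hv : h u = h v
          · simp [hv, mul_div_assoc]
          · simp [hv, Ne.symm hv]
      _ ≤ ∑ u, p u := Finset.sum_le_sum fun u _ =>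
          mul_le_of_le_one_right (hp.nonneg u) (div_self_le_one _)
      _ = 1 := hp.sum_eq_one
  have main : ∑ w, (p w * -Real.log (fiberMass p J w) + p w * -Real.log (fiberMass p h w))
      ≤ ∑ w, (p w * -Real.log (fiberMass p F w) + p w * -Real.log (fiberMass p G w)) := by
    have : ∀ w, (p w * -Real.log (fiberMass p J w) + p w * -Real.log (fiberMass p h w))
        - (p w * -Real.log (fiberMass p F w) + p w * -Real.log (fiberMass p G w))
        ≤ p w * (fiberMass p F w * fiberMass p G w /
          (fiberMass p J w * fiberMass p h w)) - p w := by
      intro w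
      rcases (hp.nonneg w).eq_or_lt with h0 | h0
      · simp [← h0]
      · have hFw := h0.trans_le (le_fiberMass hp F w)
        have hGw := h0.trans_le (le_fiberMass hp G w)
        have hJw := h0.trans_le (le_fiberMass hp J w)
        have hhw := h0.trans_le (le_fiberMass hp h w)
        have hl := Real.log_le_sub_one_of_pos (div_pos (mul_pos hFw hGw) (mul_pos hJw hhw))
        rw [Real.log_div (mul_pos hFw hGw).ne' (mul_pos hJw hhw).ne',
          Real.log_mul hFw.ne' hGw.ne', Real.log_mul hJw.ne' hhw.ne'] at hl
        have := mul_le_mul_of_nonneg_left hl h0.le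
        linarith
    have hsum := Finset.sum_le_sum fun w (_ : w ∈ Finset.univ) => this w
    rw [Finset.sum_sub_distrib, Finset.sum_sub_distrib, hp.sum_eq_one] at hsum
    linarith
  rw [Finset.sum_add_distrib, Finset.sum_add_distrib] at main
  simp only [finEntropy, ← add_div]
  exact div_le_div_of_nonneg_right main log_two_pos.le

theorem finEntropy_pair_le (hp : IsProbVec p) (f : V → α) (g : V → β) :
    finEntropy p (fun w => (f w, g w)) ≤ finEntropy p f + finEntropy p g := by
  have h := finEntropy_submodular hp f g (fun _ => ())
  rw [finEntropy_const hp, add_zero] at h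
  calc _ = finEntropy p (fun w => (f w, g w, ())) := finEntropy_congr hp fun v w => by simp
    _ ≤ _ := h
    _ = _ := by
      congr 1 <;> exact finEntropy_congr hp fun v w => by simp

/-- A random variable with values in a finite type has entropy at most `log₂` of the size of that
type. -/
theorem finEntropy_le_log_card [Fintype α] (hp : IsProbVec p) (f : V → α) :
    finEntropy p f ≤ Real.log (Fintype.card α) / Real.log 2 := by
  classical
  refine div_le_div_of_nonneg_right ?_ log_two_pos.le
  obtain ⟨w₀⟩ : Nonempty V := by
    by_contra hV
    rw [not_nonempty_iff] at hV
    simpa using hp.sum_eq_one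
  have hc : (0 : ℝ) < Fintype.card α := by exact_mod_cast Fintype.card_pos_iff.2 ⟨f w₀⟩
  have h1 : ∀ w, p w * -Real.log (fiberMass p f w) - p w * Real.log (Fintype.card α)
      ≤ (p w / fiberMass p f w) / Fintype.card α - p w := by
    intro w
    rcases (hp.nonneg w).eq_or_lt with h0 | h0
    · simp [← h0]
    · have hf := h0.trans_le (le_fiberMass hp f w)
      have hl := Real.log_le_sub_one_of_pos (inv_pos.2 (mul_pos hf hc))
      rw [Real.log_inv, Real.log_mul hf.ne' hc.ne'] at hl
      have := mul_le_mul_of_nonneg_left hl h0.le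
      have e : p w / fiberMass p f w / Fintype.card α
        = p w * (fiberMass p f w * Fintype.card α)⁻¹ := by
        rw [div_div, div_eq_mul_inv]
      rw [e]
      linarith
  have h2 : ∑ w, p w / fiberMass p f w ≤ Fintype.card α := by
    calc ∑ w, p w / fiberMass p f w
        = ∑ w, ∑ a, (if f w = a then p w / fiberMass p f w else 0) := by simp
      _ = ∑ a, ∑ w, (if f w = a then p w / fiberMass p f w else 0) := Finset.sum_comm
      _ ≤ ∑ _a : α, (1 : ℝ) := Finset.sum_le_sum fun a _ => sum_div_fiberMass_le_one p f a
      _ = Fintype.card α := by simp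
  have h3 := Finset.sum_le_sum fun w (_ : w ∈ Finset.univ) => h1 w
  rw [Finset.sum_sub_distrib, Finset.sum_sub_distrib, ← Finset.sum_mul, ← Finset.sum_div,
    hp.sum_eq_one] at h3
  have h4 := (div_le_one hc).2 h2
  linarith

theorem finEntropy_le_log_card_domain (hp : IsProbVec p) (f : V → α) :
    finEntropy p f ≤ Real.log (Fintype.card V) / Real.log 2 :=
  (finEntropy_le_of_factor (g := id) hp fun _ _ h => congrArg f h).trans
    (finEntropy_le_log_card hp id)

theorem finCondEntropy_le (hp : IsProbVec p) (f : V → α) (g : V → β) :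
    finCondEntropy p f g ≤ Real.log (Fintype.card V) / Real.log 2 :=
  (sub_le_self _ (finEntropy_nonneg hp g)).trans (finEntropy_le_log_card_domain hp _)

theorem finCondEntropy_pair_le (hp : IsProbVec p) (f : V → α) (g : V → β) (h : V → γ) :
    finCondEntropy p (fun w => (f w, g w)) h ≤ finEntropy p f + finCondEntropy p g h := by
  have h1 := finEntropy_pair_le hp f (fun w => (g w, h w))
  have h2 : finEntropy p (fun w => ((f w, g w), h w)) = finEntropy p (fun w => (f w, g w, h w)) :=
    finEntropy_congr hp fun v w => by simp [and_assoc]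
  rw [finCondEntropy, finCondEntropy, h2]
  linarith

/-- Conditional entropy is subadditive along a finite family. -/
theorem finCondEntropy_pi_le {ι : Type*} [Fintype ι] {A : ι → Type*} (hp : IsProbVec p)
    (f : ∀ i, V → A i) (g : V → β) :
    finCondEntropy p (fun w i => f i w) g ≤ ∑ i, finCondEntropy p (f i) g := by
  classical
  have key : ∀ s : Finset ι, finCondEntropy p (fun w (i : s) => f i w) g
      ≤ ∑ i ∈ s, finCondEntropy p (f i) g := by
    intro s
    induction s using Finset.induction_on with
    | empty =>
      simp only [Finset.sum_empty, finCondEntropy, sub_nonpos]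
      refine finEntropy_le_of_factor hp fun v w h => ?_
      rw [Prod.ext_iff]
      exact ⟨funext fun i => absurd i.2 (Finset.notMem_empty _), h⟩
    | insert i s hi ih =>
      rw [Finset.sum_insert hi]
      have h1 := finEntropy_submodular hp (f i) (fun w (j : s) => f j w) g
      have h2 : finEntropy p (fun w => ((fun j : ↥(insert i s) => f j w), g w))
          ≤ finEntropy p (fun w => (f i w, (fun j : s => f j w), g w)) := by
        refine finEntropy_le_of_factor hp fun v w h => ?_
        simp only [Prod.mk.injEq] at h ⊢
        refine ⟨funext fun j => ?_, h.2.2⟩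
        obtain ⟨j, hj⟩ := j
        rcases Finset.mem_insert.1 hj with rfl | hj
        · exact h.1
        · exact congrFun h.2.1 ⟨j, hj⟩
      simp only [finCondEntropy] at ih ⊢
      linarith
  refine le_trans (finCondEntropy_mono hp (fun v w h => ?_) g) (key Finset.univ)
  exact funext fun i => congrFun h ⟨i, Finset.mem_univ i⟩

/-- The entropy as a sum over a finite set that contains all values. -/
theorem finEntropy_eq_sum [DecidableEq α] (p : V → ℝ) (f : V → α) (s : Finset α)
    (hs : ∀ v, f v ∈ s) :
    finEntropy p f
      = ∑ a ∈ s, Real.negMulLog (∑ v, if f v = a then p v else 0) / Real.log 2 := by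
  rw [finEntropy, ← Finset.sum_div]
  congr 1
  have : ∀ w, p w * -Real.log (fiberMass p f w)
      = ∑ a ∈ s, if f w = a then p w * -Real.log (∑ v, if f v = a then p v else 0) else 0 := by
    intro w
    rw [Finset.sum_ite_eq, if_pos (hs w), fiberMass_eq_sum]
  simp_rw [this]
  rw [Finset.sum_comm]
  refine Finset.sum_congr rfl fun a _ => ?_
  rw [Real.negMulLog, neg_mul, ← mul_neg, Finset.sum_mul]
  exact Finset.sum_congr rfl fun w _ => by split_ifs <;> simp

open scoped Classical in
/-- The weights `p` conditioned on the fibre of `g` through `w`. -/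
noncomputable def condWeights (p : V → ℝ) (g : V → β) (w v : V) : ℝ :=
  if g v = g w then p v / fiberMass p g w else 0

theorem isProbVec_condWeights (hp : IsProbVec p) (g : V → β) {w : V} (hw : 0 < p w) :
    IsProbVec (condWeights p g w) := by
  classical
  have hg := hw.trans_le (le_fiberMass hp g w)
  refine ⟨fun v => ?_, ?_⟩
  · unfold condWeights
    split_ifs
    exacts [div_nonneg (hp.nonneg v) hg.le, le_rfl]
  · have : ∀ v, condWeights p g w v = (if g v = g w then p v else 0) / fiberMass p g w := by
      intro v
      unfold condWeights
      split_ifs <;> simp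
    simp_rw [this, ← Finset.sum_div]
    exact div_self hg.ne'

/-- The chain rule: `H(f, g) - H(g)` is the mean of the entropies of `f` under the conditional
laws given `g`. -/
theorem sum_mul_finEntropy_condWeights (hp : IsProbVec p) (f : V → α) (g : V → β) :
    ∑ w, p w * finEntropy (condWeights p g w) f = finCondEntropy p f g := by
  classical
  set J := fun w => (f w, g w) with hJ
  have e0 : ∀ w, 0 < p w → ∀ v, condWeights p g w v * -Real.log (fiberMass (condWeights p g w) f v)
      = (if g v = g w then p w / fiberMass p g w else 0) *
        (p v * (Real.log (fiberMass p g v) - Real.log (fiberMass p J v))) / p w := by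
    intro w hw v
    have hgw := hw.trans_le (le_fiberMass hp g w)
    by_cases hv : g v = g w
    · rcases (hp.nonneg v).eq_or_lt with h0 | h0
      · simp [condWeights, ← h0]
      have e1 : fiberMass (condWeights p g w) f v = fiberMass p J v / fiberMass p g w := by
        rw [fiberMass, fiberMass, Finset.sum_div]
        refine Finset.sum_congr rfl fun u _ => ?_
        by_cases h1 : f u = f v <;> by_cases h2 : g u = g w <;> simp [condWeights, hJ, h1, h2, hv]
      have hJv := h0.trans_le (le_fiberMass hp J v)
      rw [e1, Real.log_div hJv.ne' hgw.ne', fiberMass_congr hv, condWeights, if_pos hv, if_pos hv]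
      field_simp
      ring
    · simp [condWeights, hv]
  have e2 : ∀ w, p w * finEntropy (condWeights p g w) f
      = (∑ v, (if g v = g w then p w / fiberMass p g w else 0) *
        (p v * (Real.log (fiberMass p g v) - Real.log (fiberMass p J v)))) / Real.log 2 := by
    intro w
    rcases (hp.nonneg w).eq_or_lt with h0 | h0
    · simp [← h0]
    · rw [finEntropy, mul_div_assoc', Finset.mul_sum]
      congr 1
      refine Finset.sum_congr rfl fun v _ => ?_
      rw [e0 w h0 v]
      field_simp
  simp_rw [e2]
  rw [← Finset.sum_div, Finset.sum_comm, finCondEntropy, finEntropy, finEntropy, ← sub_div,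
    ← Finset.sum_sub_distrib]
  congr 1
  refine Finset.sum_congr rfl fun v _ => ?_
  rw [← Finset.sum_mul]
  rcases (hp.nonneg v).eq_or_lt with h0 | h0
  · simp [← h0]
  · have hgv := h0.trans_le (le_fiberMass hp g v)
    have : ∑ w, (if g v = g w then p w / fiberMass p g w else 0) = 1 := by
      rw [← div_self hgv.ne']
      conv_rhs => rw [fiberMass_eq_sum p g, Finset.sum_div, ← fiberMass_eq_sum]
      refine Finset.sum_congr rfl fun w _ => ?_
      by_cases hw : g v = g w
      · simp [hw, fiberMass_congr hw]
      · simp [hw, Ne.symm hw]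
    rw [this]
    ring

end FiniteEntropy

/-! ### Entropy of countable random variables -/

section Countable

variable {Ω A B : Type} [MeasurableSpace Ω] {μ : Measure Ω}

theorem entropy_eq_finEntropy {V : Type*} [Fintype V] [DecidableEq A] {p : V → ℝ}
    (hp : IsProbVec p) {X : Ω → A} (f : V → A)
    (h : ∀ a, μ.real (X ⁻¹' {a}) = ∑ v, if f v = a then p v else 0) :
    entropy μ X = ENNReal.ofReal (finEntropy p f) := by
  have h01 : ∀ a, 0 ≤ Real.negMulLog (∑ v, if f v = a then p v else 0) / Real.log 2 := by
    intro a
    refine div_nonneg (Real.negMulLog_nonneg ?_ ?_) log_two_pos.le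
    · exact Finset.sum_nonneg fun v _ => by split_ifs; exacts [hp.nonneg v, le_rfl]
    · rw [← hp.sum_eq_one]
      exact Finset.sum_le_sum fun v _ => by split_ifs; exacts [le_rfl, hp.nonneg v]
  rw [entropy, tsum_eq_sum (s := Finset.univ.image f),
    finEntropy_eq_sum p f (Finset.univ.image f) (by simp),
    ENNReal.ofReal_sum_of_nonneg fun a _ => h01 a]
  · simp_rw [h]
  · intro a ha
    have : ∀ v, f v ≠ a := by simpa using ha
    simp [h, this]

theorem entropy_congr_ae {X X' : Ω → A} (h : X =ᵐ[μ] X') : entropy μ X = entropy μ X' := by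
  unfold entropy
  congr! 5 with a
  exact measureReal_congr (h.preimage {a})

theorem condEntropy_congr_ae {X X' : Ω → A} {Y Y' : Ω → B} (hX : X =ᵐ[μ] X') (hY : Y =ᵐ[μ] Y') :
    condEntropy μ X Y = condEntropy μ X' Y' := by
  unfold condEntropy
  congr! 2 with b
  have h : (Y ⁻¹' {b} : Set Ω) =ᵐ[μ] Y' ⁻¹' {b} := hY.preimage {b}
  rw [measure_congr h, ProbabilityTheory.cond, measure_congr h, Measure.restrict_congr_set h,
    ← ProbabilityTheory.cond]
  exact congrArg _ (entropy_congr_ae (cond_absolutelyContinuous.ae_le hX))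

theorem condEntropy_eq_lintegral_fiber [Countable B] (X : Ω → A) {Y : Ω → B}
    (hY : ∀ b, MeasurableSet (Y ⁻¹' {b})) :
    condEntropy μ X Y = ∫⁻ ω, entropy (μ[|Y ⁻¹' {Y ω}]) X ∂μ := by
  let _ : MeasurableSpace B := ⊤
  have hYm : Measurable Y := measurable_to_countable' hY
  rw [← lintegral_map (f := fun b => entropy (μ[|Y ⁻¹' {b}]) X) .of_discrete hYm,
    lintegral_countable', condEntropy]
  refine tsum_congr fun b => ?_
  rw [Measure.map_apply hYm (measurableSet_singleton b), mul_comm]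

/-- Conditioning does not increase entropy: Jensen's inequality for the concave function
`- x log x`, letter by letter. -/
theorem condEntropy_le_entropy [IsProbabilityMeasure μ] [Countable B] {X : Ω → A} {Y : Ω → B}
    (hX : ∀ a, MeasurableSet (X ⁻¹' {a})) (hY : ∀ b, MeasurableSet (Y ⁻¹' {b})) :
    condEntropy μ X Y ≤ entropy μ X := by
  let _ : MeasurableSpace B := ⊤
  have hYm : Measurable Y := measurable_to_countable' hY
  simp only [condEntropy, entropy, ← ENNReal.tsum_mul_left]
  rw [ENNReal.tsum_comm]
  refine ENNReal.tsum_le_tsum fun a => ?_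
  set g : B → ℝ := fun b => (μ[|Y ⁻¹' {b}]).real (X ⁻¹' {a}) with hg
  have hg0 : ∀ b, 0 ≤ g b := fun b => measureReal_nonneg
  have hg1 : ∀ b, g b ≤ 1 := fun b => by
    by_cases hb : μ (Y ⁻¹' {b}) = 0
    · simp [hg, ProbabilityTheory.cond, Measure.restrict_eq_zero.2 hb]
    · have := cond_isProbabilityMeasure hb
      exact measureReal_le_one
  have hη0 : ∀ b, 0 ≤ Real.negMulLog (g b) := fun b => Real.negMulLog_nonneg (hg0 b) (hg1 b)
  have hη1 : ∀ b, Real.negMulLog (g b) ≤ 1 := fun b => by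
    have := Real.negMulLog_le_one_sub_self (hg0 b)
    linarith [hg0 b]
  have : IsProbabilityMeasure (μ.map Y) := Measure.isProbabilityMeasure_map hYm.aemeasurable
  have hgi : Integrable g (μ.map Y) := Integrable.of_bound
    (Measurable.of_discrete).aestronglyMeasurable 1
    (ae_of_all _ fun b => by rw [Real.norm_of_nonneg (hg0 b)]; exact hg1 b)
  have hηi : Integrable (Real.negMulLog ∘ g) (μ.map Y) := Integrable.of_bound
    (Measurable.of_discrete).aestronglyMeasurable 1
    (ae_of_all _ fun b => by
      rw [Function.comp_apply, Real.norm_of_nonneg (hη0 b)]; exact hη1 b)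
  have hJ := Real.concaveOn_negMulLog.le_map_integral Real.continuous_negMulLog.continuousOn
    isClosed_Ici (ae_of_all _ hg0) hgi hηi
  have hmean : ∫ b, g b ∂(μ.map Y) = μ.real (X ⁻¹' {a}) := by
    rw [integral_eq_lintegral_of_nonneg_ae (ae_of_all _ hg0)
      (Measurable.of_discrete).aestronglyMeasurable, lintegral_countable', measureReal_def]
    congr 1
    have hdisj : Pairwise (Function.onFun Disjoint fun b => Y ⁻¹' {b} ∩ X ⁻¹' {a}) := by
      intro b b' hb
      refine Set.disjoint_left.2 fun ω h h' => hb ?_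
      exact h.1.symm.trans h'.1
    have hun : X ⁻¹' {a} = ⋃ b, (Y ⁻¹' {b} ∩ X ⁻¹' {a}) := by
      ext ω
      simp
    rw [hun, measure_iUnion hdisj fun b => (hY b).inter (hX a)]
    refine tsum_congr fun b => ?_
    rw [Measure.map_apply hYm (measurableSet_singleton b), hg, ofReal_measureReal,
      cond_mul_eq_inter (hY b)]
  rw [hmean] at hJ
  calc ∑' b, μ (Y ⁻¹' {b}) * ENNReal.ofReal (Real.negMulLog (g b) / Real.log 2)
      = ∫⁻ b, ENNReal.ofReal (Real.negMulLog (g b) / Real.log 2) ∂(μ.map Y) := by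
        rw [lintegral_countable']
        refine tsum_congr fun b => ?_
        rw [Measure.map_apply hYm (measurableSet_singleton b), mul_comm]
    _ = ENNReal.ofReal (∫ b, Real.negMulLog (g b) / Real.log 2 ∂(μ.map Y)) :=
        (ofReal_integral_eq_lintegral_ofReal (hηi.div_const _)
          (ae_of_all _ fun b => div_nonneg (hη0 b) log_two_pos.le)).symm
    _ ≤ _ := by
        rw [integral_div]
        exact ENNReal.ofReal_le_ofReal (div_le_div_of_nonneg_right hJ log_two_pos.le)

/-- If `H(X | Y) = 0` then `X` is almost surely a function of `Y`. -/
theorem exists_ae_eq_of_condEntropy_eq_zero [IsProbabilityMeasure μ] [Countable A] [Countable B]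
    {X : Ω → A} {Y : Ω → B} (hX : ∀ a, MeasurableSet (X ⁻¹' {a}))
    (hY : ∀ b, MeasurableSet (Y ⁻¹' {b})) (h : condEntropy μ X Y = 0) :
    ∃ f : B → A, ∀ᵐ ω ∂μ, X ω = f (Y ω) := by
  let _ : MeasurableSpace A := ⊤
  have hXm : Measurable X := measurable_to_countable' hX
  have key : ∀ b, ∃ a, μ (Y ⁻¹' {b} ∩ (X ⁻¹' {a})ᶜ) = 0 := by
    intro b
    by_cases hb : μ (Y ⁻¹' {b}) = 0
    · have := nonempty_of_isProbabilityMeasure μ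
      exact ⟨X (Classical.arbitrary Ω), measure_mono_null Set.inter_subset_left hb⟩
    have := cond_isProbabilityMeasure hb
    set ν := μ[|Y ⁻¹' {b}] with hν
    have h1 : entropy ν X = 0 := (mul_eq_zero.1 (ENNReal.tsum_eq_zero.1 h b)).resolve_left hb
    obtain ⟨a, ha⟩ : ∃ a, ν (X ⁻¹' {a}) ≠ 0 := by
      by_contra! hall
      have hun : (⋃ a, X ⁻¹' {a}) = Set.univ := by
        ext ω
        simp
      have := measure_iUnion_null hall
      rw [hun, measure_univ] at this
      exact one_ne_zero this
    have ha' : ν.real (X ⁻¹' {a}) ≠ 0 := by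
      rw [measureReal_def]
      exact ENNReal.toReal_ne_zero.2 ⟨ha, measure_ne_top _ _⟩
    have h2 := ENNReal.ofReal_eq_zero.1 (ENNReal.tsum_eq_zero.1 h1 a)
    have h3 : ν.real (X ⁻¹' {a}) = 1 := by
      have hpos : 0 < ν.real (X ⁻¹' {a}) := lt_of_le_of_ne measureReal_nonneg (Ne.symm ha')
      have hle : ν.real (X ⁻¹' {a}) ≤ 1 := measureReal_le_one
      by_contra hne
      have hlog := Real.log_neg hpos (lt_of_le_of_ne hle hne)
      have : 0 < Real.negMulLog (ν.real (X ⁻¹' {a})) / Real.log 2 := by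
        refine div_pos ?_ log_two_pos
        rw [Real.negMulLog]
        nlinarith
      linarith
    refine ⟨a, ?_⟩
    have h4 : ν (X ⁻¹' {a})ᶜ = 0 := by
      rw [prob_compl_eq_zero_iff (hX a), ← ENNReal.ofReal_one, ← h3, ofReal_measureReal]
    rw [hν, cond_apply (hY b), mul_eq_zero] at h4
    exact h4.resolve_left (ENNReal.inv_ne_zero.2 (measure_ne_top _ _))
  choose f hf using key
  refine ⟨f, ?_⟩
  have : ∀ᵐ ω ∂μ, ∀ b, ω ∉ Y ⁻¹' {b} ∩ (X ⁻¹' {f b})ᶜ :=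
    ae_all_iff.2 fun b => measure_eq_zero_iff_ae_notMem.1 (hf b)
  filter_upwards [this] with ω hω
  by_contra hne
  exact hω (Y ω) ⟨rfl, hne⟩

end Countable

/-! ### Entropy given an independent parameter -/

section Parameter

variable {Ω A B T V : Type} [MeasurableSpace Ω] {μ : Measure Ω}
  [Fintype V] [MeasurableSpace V] [DiscreteMeasurableSpace V]
  [MeasurableSpace T] [DiscreteMeasurableSpace T] {W : Ω → V} {τ : Ω → T}

/-- The law of a random variable with finitely many values, as a vector of weights. -/
noncomputable def lawVec (μ : Measure Ω) (W : Ω → V) (v : V) : ℝ := μ.real (W ⁻¹' {v})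

theorem isProbVec_lawVec [IsProbabilityMeasure μ] (hW : Measurable W) : IsProbVec (lawVec μ W) := by
  refine ⟨fun v => measureReal_nonneg, ?_⟩
  have := Measure.isProbabilityMeasure_map (μ := μ) hW.aemeasurable
  have h := sum_measureReal_singleton (μ := μ.map W) Finset.univ
  rw [Finset.coe_univ, probReal_univ] at h
  rw [← h]
  refine Finset.sum_congr rfl fun v _ => ?_
  rw [map_measureReal_apply hW (measurableSet_singleton v), lawVec]

open scoped Classical in
theorem measureReal_setOf_eq_sum_lawVec [IsFiniteMeasure μ] (hW : Measurable W) (P : V → Prop) :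
    μ.real (W ⁻¹' {v | P v}) = ∑ v, if P v then lawVec μ W v else 0 := by
  rw [← map_measureReal_apply hW .of_discrete, ← Finset.sum_filter]
  have h := sum_measureReal_singleton (μ := μ.map W) (Finset.univ.filter fun v => P v)
  rw [Finset.coe_filter] at h
  simp only [Finset.mem_univ, true_and] at h
  rw [← h]
  refine Finset.sum_congr rfl fun v _ => ?_
  rw [map_measureReal_apply hW (measurableSet_singleton v), lawVec]

open scoped Classical in
theorem measureReal_preimage_eq_sum [IsProbabilityMeasure μ] (hW : Measurable W)
    (hind : IndepFun W τ μ) (t : T) (P : V → Prop) :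
    μ.real {ω | τ ω = t ∧ P (W ω)}
      = μ.real (τ ⁻¹' {t}) * ∑ v, if P v then lawVec μ W v else 0 := by
  have e : {ω | τ ω = t ∧ P (W ω)} = W ⁻¹' {v | P v} ∩ τ ⁻¹' {t} := by
    ext ω
    simp [and_comm]
  rw [e, measureReal_def, hind.measure_inter_preimage_eq_mul _ _ (.of_discrete) (.of_discrete),
    ENNReal.toReal_mul, mul_comm, ← measureReal_def, ← measureReal_def,
    measureReal_setOf_eq_sum_lawVec hW]

theorem finEntropy_pair_of_indepFun [IsProbabilityMeasure μ] (hW : Measurable W)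
    [MeasurableSpace A] [MeasurableSingletonClass A] [MeasurableSpace B]
    [MeasurableSingletonClass B] {f : V → A} {g : V → B}
    (h : IndepFun (fun ω => f (W ω)) (fun ω => g (W ω)) μ) :
    finEntropy (lawVec μ W) (fun v => (f v, g v))
      = finEntropy (lawVec μ W) f + finEntropy (lawVec μ W) g := by
  classical
  have hp : IsProbVec (lawVec μ W) := isProbVec_lawVec hW
  set p := lawVec μ W with hpdef
  have hm : ∀ v, fiberMass p (fun v => (f v, g v)) v = fiberMass p f v * fiberMass p g v := by
    intro v
    have e : W ⁻¹' {u | (f u, g u) = (f v, g v)}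
        = (fun ω => f (W ω)) ⁻¹' {f v} ∩ (fun ω => g (W ω)) ⁻¹' {g v} := by
      ext ω
      simp
    have h1 := measureReal_setOf_eq_sum_lawVec (μ := μ) hW fun u => (f u, g u) = (f v, g v)
    have h2 := measureReal_setOf_eq_sum_lawVec (μ := μ) hW fun u => f u = f v
    have h3 := measureReal_setOf_eq_sum_lawVec (μ := μ) hW fun u => g u = g v
    rw [fiberMass, fiberMass, fiberMass, hpdef, ← h1, ← h2, ← h3, e, measureReal_def,
      h.measure_inter_preimage_eq_mul _ _ (measurableSet_singleton _) (measurableSet_singleton _),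
      ENNReal.toReal_mul]
    rfl
  rw [finEntropy, finEntropy, finEntropy, ← add_div, ← Finset.sum_add_distrib]
  congr 1
  refine Finset.sum_congr rfl fun v _ => ?_
  rcases (hp.nonneg v).eq_or_lt with h0 | h0
  · simp [← h0]
  · rw [hm, Real.log_mul (h0.trans_le (le_fiberMass hp f v)).ne'
      (h0.trans_le (le_fiberMass hp g v)).ne']
    ring

theorem lintegral_indep_eq_sum [IsProbabilityMeasure μ] [Countable T] (hW : Measurable W)
    (hτ : Measurable τ) (hind : IndepFun W τ μ)
    (F : T → V → ℝ≥0∞) :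
    ∫⁻ ω, F (τ ω) (W ω) ∂μ = ∫⁻ ω, ∑ v, ENNReal.ofReal (lawVec μ W v) * F (τ ω) v ∂μ := by
  have h := (indepFun_iff_map_prod_eq_prod_map_map hτ.aemeasurable hW.aemeasurable).1 hind.symm
  have hm : Measurable fun x : T × V => F x.1 x.2 := .of_discrete
  calc ∫⁻ ω, F (τ ω) (W ω) ∂μ
      = ∫⁻ x, F x.1 x.2 ∂(μ.map fun ω => (τ ω, W ω)) := (lintegral_map hm (hτ.prodMk hW)).symm
    _ = ∫⁻ t, ∫⁻ v, F t v ∂(μ.map W) ∂(μ.map τ) := by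
        rw [h, lintegral_prod _ hm.aemeasurable]
    _ = ∫⁻ ω, ∫⁻ v, F (τ ω) v ∂(μ.map W) ∂μ := lintegral_map .of_discrete hτ
    _ = _ := by
        refine lintegral_congr fun ω => ?_
        rw [lintegral_fintype]
        refine Finset.sum_congr rfl fun v _ => ?_
        rw [Measure.map_apply hW (measurableSet_singleton v), lawVec, ofReal_measureReal, mul_comm]

theorem ae_measure_fiber_ne_zero [Countable T] (hτ : Measurable τ) :
    ∀ᵐ ω ∂μ, μ (τ ⁻¹' {τ ω}) ≠ 0 := by
  have h : ∀ᵐ t ∂(μ.map τ), μ (τ ⁻¹' {t}) ≠ 0 := by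
    rw [ae_iff_of_countable]
    intro t ht
    rwa [Measure.map_apply hτ (measurableSet_singleton t)] at ht
  exact ae_of_ae_map hτ.aemeasurable h

/-- Let `τ` be independent of `W`, let `X = φ(τ, W)`, and let `Y = ψ(τ, W)` determine `τ`. Then
`H(X | Y)` is the mean over `τ` of the conditional entropy of `φ(τ, ·)` given `ψ(τ, ·)` on the
finite probability space that carries the law of `W`. -/
theorem condEntropy_eq_lintegral [IsProbabilityMeasure μ] [Countable T] [Countable B]
    (hW : Measurable W) (hτ : Measurable τ)
    (hind : IndepFun W τ μ) (φ : T → V → A) (ψ : T → V → B)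
    (hψ : ∀ t t' v v', ψ t v = ψ t' v' → t = t') {X : Ω → A} {Y : Ω → B}
    (hX : ∀ᵐ ω ∂μ, X ω = φ (τ ω) (W ω)) (hY : ∀ᵐ ω ∂μ, Y ω = ψ (τ ω) (W ω)) :
    condEntropy μ X Y
      = ∫⁻ ω, ENNReal.ofReal (finCondEntropy (lawVec μ W) (φ (τ ω)) (ψ (τ ω))) ∂μ := by
  classical
  have hp : IsProbVec (lawVec μ W) := isProbVec_lawVec hW
  set p := lawVec μ W with hpdef
  rw [condEntropy_congr_ae hX hY, condEntropy_eq_lintegral_fiber]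
  swap
  · intro b
    exact (hτ.prodMk hW) (MeasurableSet.of_discrete (s := {x : T × V | ψ x.1 x.2 = b}))
  set E : T → V → ℝ≥0∞ := fun t v =>
    entropy (μ[|(fun ω => ψ (τ ω) (W ω)) ⁻¹' {ψ t v}]) fun ω => φ (τ ω) (W ω) with hE
  -- By independence the value of `W` may be averaged separately for each value `t` of `τ`.
  rw [lintegral_indep_eq_sum hW hτ hind E]
  refine lintegral_congr_ae ?_
  filter_upwards [ae_measure_fiber_ne_zero hτ] with ω hω
  set t := τ ω with ht
  -- Given `ψ(τ, W) = ψ t v`, the law of `φ(τ, W)` is that of `φ t` on the fibre of `ψ t`.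
  have hE' : ∀ v, ENNReal.ofReal (p v) * E t v
      = ENNReal.ofReal (p v * finEntropy (condWeights p (ψ t) v) (φ t)) := by
    intro v
    rcases (hp.nonneg v).eq_or_lt with h0 | h0
    · simp [← h0]
    · rw [ENNReal.ofReal_mul h0.le]
      congr 1
      refine entropy_eq_finEntropy (isProbVec_condWeights hp _ h0) _ fun a => ?_
      have e1 : (fun ω => ψ (τ ω) (W ω)) ⁻¹' {ψ t v} = {ω | τ ω = t ∧ ψ t (W ω) = ψ t v} := by
        ext ω'
        simp only [Set.mem_preimage, Set.mem_singleton_iff, Set.mem_ofPred_eq]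
        constructor
        · intro h
          have := hψ _ _ _ _ h
          exact ⟨this, this ▸ h⟩
        · rintro ⟨h1, h2⟩
          rw [h1, h2]
      have e2 : {ω | τ ω = t ∧ ψ t (W ω) = ψ t v} ∩ (fun ω => φ (τ ω) (W ω)) ⁻¹' {a}
          = {ω | τ ω = t ∧ (ψ t (W ω) = ψ t v ∧ φ t (W ω) = a)} := by
        ext ω'
        simp only [Set.mem_inter_iff, Set.mem_preimage, Set.mem_singleton_iff, Set.mem_ofPred_eq]
        constructor
        · rintro ⟨⟨h1, h2⟩, h3⟩
          exact ⟨h1, h2, h1 ▸ h3⟩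
        · rintro ⟨h1, h2, h3⟩
          exact ⟨⟨h1, h2⟩, by rw [h1, h3]⟩
      have hms : MeasurableSet {ω | τ ω = t ∧ ψ t (W ω) = ψ t v} :=
        (hτ.prodMk hW) (MeasurableSet.of_discrete (s := {x : T × V | x.1 = t ∧ ψ t x.2 = ψ t v}))
      have ht0 : μ.real (τ ⁻¹' {t}) ≠ 0 := by
        rw [measureReal_def]
        exact ENNReal.toReal_ne_zero.2 ⟨hω, measure_ne_top _ _⟩
      rw [e1, measureReal_def, cond_apply hms, ENNReal.toReal_mul, ENNReal.toReal_inv,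
        ← measureReal_def, ← measureReal_def, e2,
        measureReal_preimage_eq_sum hW hind t fun u => ψ t u = ψ t v ∧ φ t u = a,
        measureReal_preimage_eq_sum hW hind t fun u => ψ t u = ψ t v]
      rw [mul_inv, mul_mul_mul_comm, inv_mul_cancel₀ ht0, one_mul, Finset.mul_sum]
      refine Finset.sum_congr rfl fun u _ => ?_
      rw [condWeights, fiberMass_eq_sum]
      by_cases h1 : ψ t u = ψ t v <;> by_cases h2 : φ t u = a <;>
        simp [h1, h2, div_eq_inv_mul, hpdef]
  rw [Finset.sum_congr rfl fun v _ => hE' v, ← ENNReal.ofReal_sum_of_nonneg,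
    sum_mul_finEntropy_condWeights hp]
  intro v _
  rcases (hp.nonneg v).eq_or_lt with h0 | h0
  · simp [← h0]
  · exact mul_nonneg h0.le (finEntropy_nonneg (isProbVec_condWeights hp _ h0) _)

end Parameter

/-! ### The observation of the user -/

/-- The messages with index in `s`. -/
def restrictMsg {K L : ℕ} (s : Finset (Fin K)) (w : Fin K → Fin L → Bool) :
    s → Fin L → Bool := fun k => w k

/-- What the user holds from database `n`: its answer, as a function `f n` of the query `q` and of
the messages, together with the bits that were prefetched at the positions `h`. -/
def observe {K N L : ℕ} {Query Answer : Type}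
    (f : Fin N → Query → (Fin K → Fin L → Bool) → Answer) (n : Fin N)
    (h : Fin K → Finset (Fin L)) (q : Query) (w : Fin K → Fin L → Bool) :
    Answer × (Fin K → Fin L → Option Bool) := (f n q w, cacheContent h w)

/-- If `c` positions are cached from each message, then the cache content adds at most `c` bits of
uncertainty for each message that is not in the known set `s`. -/
theorem finCondEntropy_cacheContent_le {K L c : ℕ} {p : (Fin K → Fin L → Bool) → ℝ}
    (hp : IsProbVec p) {h : Fin K → Finset (Fin L)} (hc : ∀ k, (h k).card = c)
    (s : Finset (Fin K)) :
    finCondEntropy p (cacheContent h) (restrictMsg s) ≤ ((K : ℝ) - s.card) * c := by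
  classical
  let g : (Fin K → Fin L → Bool) → ((Σ k : ↥sᶜ, ↥(h k)) → Bool) := fun w x => w x.1 x.2
  have h1 : finEntropy p (fun w => (cacheContent h w, restrictMsg s w))
      ≤ finEntropy p (fun w => (g w, restrictMsg s w)) := by
    refine finEntropy_le_of_factor hp fun v w hvw => ?_
    simp only [Prod.mk.injEq] at hvw ⊢
    refine ⟨?_, hvw.2⟩
    funext k l
    unfold cacheContent
    by_cases hl : l ∈ h k
    · rw [if_pos hl, if_pos hl]
      by_cases hk : k ∈ s
      · exact congrArg some (congrFun (congrFun hvw.2 ⟨k, hk⟩) l)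
      · exact congrArg some (congrFun hvw.1 ⟨⟨k, Finset.mem_compl.2 hk⟩, ⟨l, hl⟩⟩)
    · rw [if_neg hl, if_neg hl]
  have h2 := finEntropy_pair_le hp g (restrictMsg s)
  have h3 := finEntropy_le_log_card hp g
  have h4 : Fintype.card ((Σ k : ↥sᶜ, ↥(h k)) → Bool) = 2 ^ ((K - s.card) * c) := by
    simp [Fintype.card_sigma, hc, Finset.card_compl]
  have h5 : s.card ≤ K := by simpa using s.card_le_univ
  rw [h4] at h3
  push_cast [Nat.cast_sub h5] at h3
  rw [Real.log_pow, mul_div_assoc, div_self log_two_pos.ne'] at h3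
  push_cast [Nat.cast_sub h5] at h3
  rw [finCondEntropy]
  linarith

namespace Scheme

variable {K N : ℕ} (S : Scheme K N)

/-- All messages, as one random variable. -/
def messages (ω : S.Ω) : Fin K → Fin S.L → Bool := fun k => S.W k ω

/-- The cached positions and the queries: the part of the scheme that is independent of the
messages. -/
def setup (θ : Fin K) (ω : S.Ω) : (Fin N → Fin K → Finset (Fin S.L)) × (Fin N → S.Query) :=
  (fun n => S.cached n ω, fun n => S.Q θ n ω)

/-- The law of the messages. -/
noncomputable def law : (Fin K → Fin S.L → Bool) → ℝ := lawVec S.μ S.messages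

theorem measurable_messages : Measurable S.messages := measurable_pi_lambda _ S.measurable_W

theorem measurable_setup (θ : Fin K) : Measurable (S.setup θ) :=
  (measurable_pi_lambda _ S.measurable_cached).prodMk (measurable_pi_lambda _ (S.measurable_Q θ))

theorem indepFun_messages_setup (θ : Fin K) : IndepFun S.messages (S.setup θ) S.μ :=
  S.indep_query θ

theorem isProbVec_law : IsProbVec S.law := isProbVec_lawVec S.measurable_messages

/-- Each answer is a function of the query and the messages. By privacy the same function serves
for all desired messages. -/
theorem exists_answer_function (θ₀ : Fin K) :
    ∃ f : Fin N → S.Query → (Fin K → Fin S.L → Bool) → S.Answer,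
      ∀ θ n, ∀ᵐ ω ∂S.μ, S.A θ n ω = f n (S.Q θ n ω) (S.messages ω) := by
  have h : ∀ n, ∃ f : S.Query → (Fin K → Fin S.L → Bool) → S.Answer,
      ∀ θ, ∀ᵐ ω ∂S.μ, S.A θ n ω = f (S.Q θ n ω) (S.messages ω) := by
    intro n
    obtain ⟨f, hf⟩ := exists_ae_eq_of_condEntropy_eq_zero
      (fun a => S.measurable_A θ₀ n (measurableSet_singleton a))
      (fun b => ((S.measurable_Q θ₀ n).prodMk S.measurable_messages) (measurableSet_singleton b))
      (S.answer θ₀ n)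
    refine ⟨fun q w => f (q, w), fun θ => ?_⟩
    exact (S.privacy n θ₀ θ).ae_snd (p := fun x => x.2.1 = f (x.1, x.2.2.1)) .of_discrete hf
  choose f hf using h
  exact ⟨f, fun θ n => hf n θ⟩

theorem finEntropy_message (θ : Fin K) : finEntropy S.law (fun w => w θ) = S.L := by
  classical
  have h := entropy_eq_finEntropy (μ := S.μ) (X := S.W θ) S.isProbVec_law (fun w => w θ) fun a => by
    have h := measureReal_setOf_eq_sum_lawVec (μ := S.μ) S.measurable_messages fun w => w θ = a
    refine Eq.trans ?_ (h.trans ?_)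
    · rfl
    · exact Finset.sum_congr rfl fun v _ => by congr!
  rw [S.entropy_W, ← ENNReal.ofReal_natCast,
    ENNReal.ofReal_eq_ofReal_iff (Nat.cast_nonneg _) (finEntropy_nonneg S.isProbVec_law _)] at h
  exact h.symm

/-- A message that is not among the known ones adds `L` bits to their entropy. -/
theorem finEntropy_restrictMsg_insert {θ : Fin K} {s : Finset (Fin K)} (hθ : θ ∉ s) :
    finEntropy S.law (restrictMsg (insert θ s)) = S.L + finEntropy S.law (restrictMsg s) := by
  have hind := S.indep_W.indepFun_finset {θ} s (Finset.disjoint_singleton_left.2 hθ) S.measurable_W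
  have h1 : IndepFun (fun ω => S.messages ω θ) (fun ω => restrictMsg s (S.messages ω)) S.μ :=
    hind.comp (φ := fun x : ((i : ({θ} : Finset (Fin K))) → Fin S.L → Bool) =>
      x ⟨θ, Finset.mem_singleton_self θ⟩) (ψ := id) (measurable_pi_apply _) measurable_id
  rw [← S.finEntropy_message θ, law, ← finEntropy_pair_of_indepFun S.measurable_messages
    (f := fun w => w θ) (g := restrictMsg s) h1]
  refine finEntropy_congr S.isProbVec_law fun v w => ⟨fun h => ?_, fun h => ?_⟩
  · rw [Prod.mk.injEq] at h
    funext ⟨k, hk⟩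
    rcases Finset.mem_insert.1 hk with rfl | hk
    · exact h.1
    · exact congrFun h.2 ⟨k, hk⟩
  · rw [Prod.mk.injEq]
    exact ⟨congrFun h ⟨θ, Finset.mem_insert_self _ _⟩,
      funext fun k => congrFun h ⟨k, Finset.mem_insert_of_mem k.2⟩⟩

theorem integrable_setup (θ : Fin K)
    {g : (Fin N → Fin K → Finset (Fin S.L)) × (Fin N → S.Query) → ℝ} {C : ℝ}
    (h0 : ∀ t, 0 ≤ g t) (hC : ∀ t, g t ≤ C) : Integrable (fun ω => g (S.setup θ ω)) S.μ :=
  Integrable.of_bound ((Measurable.of_discrete (f := g)).comp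
    (S.measurable_setup θ)).aestronglyMeasurable C
    (ae_of_all _ fun ω => by rw [Real.norm_of_nonneg (h0 _)]; exact hC _)

variable (f : Fin N → S.Query → (Fin K → Fin S.L → Bool) → S.Answer)

/-- All that the user holds after retrieval, as a function of the messages, for given cached
positions and queries `t`. -/
def observeAll (t : (Fin N → Fin K → Finset (Fin S.L)) × (Fin N → S.Query))
    (w : Fin K → Fin S.L → Bool) : Fin N → S.Answer × (Fin K → Fin S.L → Option Bool) :=
  fun n => observe f n (t.1 n) (t.2 n) w

/-- `H(A_{1:N}^{[θ]}, Z | W_s, ℍ, Q_{1:N}^{[θ]})`. -/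
noncomputable def jointEntropy (θ : Fin K) (s : Finset (Fin K)) : ℝ :=
  ∫ ω, finCondEntropy S.law (S.observeAll f (S.setup θ ω)) (restrictMsg s) ∂S.μ

/-- `H(A_n^{[θ]}, Z_n | W_s, ℍ_n, Q_n^{[θ]})`. -/
noncomputable def singleEntropy (θ : Fin K) (n : Fin N) (s : Finset (Fin K)) : ℝ :=
  ∫ ω, finCondEntropy S.law (observe f n (S.cached n ω) (S.Q θ n ω)) (restrictMsg s) ∂S.μ

/-- `H(W_θ | A_{1:N}^{[θ]}, Z, ℍ, Q_{1:N}^{[θ]})`, as a real number. -/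
noncomputable def residualReal (θ : Fin K) : ℝ :=
  ∫ ω, finCondEntropy S.law (fun w => w θ) (S.observeAll f (S.setup θ ω)) ∂S.μ

theorem integrable_jointEntropy (θ : Fin K) (s : Finset (Fin K)) : Integrable
    (fun ω => finCondEntropy S.law (S.observeAll f (S.setup θ ω)) (restrictMsg s)) S.μ :=
  S.integrable_setup θ (g := fun t => finCondEntropy S.law (S.observeAll f t) (restrictMsg s))
    (fun _ => finCondEntropy_nonneg S.isProbVec_law _ _)
    (fun _ => finCondEntropy_le S.isProbVec_law _ _)

theorem integrable_singleEntropy (θ : Fin K) (n : Fin N) (s : Finset (Fin K)) : Integrable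
    (fun ω => finCondEntropy S.law (observe f n (S.cached n ω) (S.Q θ n ω)) (restrictMsg s)) S.μ :=
  S.integrable_setup θ
    (g := fun t => finCondEntropy S.law (observe f n (t.1 n) (t.2 n)) (restrictMsg s))
    (fun _ => finCondEntropy_nonneg S.isProbVec_law _ _)
    (fun _ => finCondEntropy_le S.isProbVec_law _ _)

theorem integrable_residualReal (θ : Fin K) : Integrable
    (fun ω => finCondEntropy S.law (fun w => w θ) (S.observeAll f (S.setup θ ω))) S.μ :=
  S.integrable_setup θ (g := fun t => finCondEntropy S.law (fun w => w θ) (S.observeAll f t))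
    (fun _ => finCondEntropy_nonneg S.isProbVec_law _ _)
    (fun _ => finCondEntropy_le S.isProbVec_law _ _)

theorem integrable_answerEntropy (θ : Fin K) (n : Fin N) : Integrable
    (fun ω => finEntropy S.law (f n (S.Q θ n ω))) S.μ :=
  S.integrable_setup θ (g := fun t => finEntropy S.law (f n (t.2 n)))
    (fun _ => finEntropy_nonneg S.isProbVec_law _)
    (fun _ => finEntropy_le_log_card_domain S.isProbVec_law _)

theorem jointEntropy_nonneg (θ : Fin K) (s : Finset (Fin K)) : 0 ≤ S.jointEntropy f θ s :=
  integral_nonneg fun _ => finCondEntropy_nonneg S.isProbVec_law _ _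

theorem residualReal_nonneg (θ : Fin K) : 0 ≤ S.residualReal f θ :=
  integral_nonneg fun _ => finCondEntropy_nonneg S.isProbVec_law _ _

variable {f}

theorem residual_eq (hf : ∀ θ n, ∀ᵐ ω ∂S.μ, S.A θ n ω = f n (S.Q θ n ω) (S.messages ω))
    (θ : Fin K) : S.residual θ = ENNReal.ofReal (S.residualReal f θ) := by
  rw [residual, condEntropy_eq_lintegral (X := S.W θ) S.measurable_messages
    (S.measurable_setup θ) (S.indepFun_messages_setup θ) (fun _ w => w θ)
    (fun t w => ((fun n => cacheContent (t.1 n) w), t.1, t.2, fun n => f n (t.2 n) w))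
    ?_ (ae_of_all _ fun _ => rfl) ?_, residualReal, ofReal_integral_eq_lintegral_ofReal
    (S.integrable_residualReal f θ)
    (ae_of_all _ fun _ => finCondEntropy_nonneg S.isProbVec_law _ _)]
  · refine lintegral_congr fun ω => ?_
    rw [← law]
    congr 1
    refine finCondEntropy_congr_right S.isProbVec_law _ fun v w => ?_
    simp only [observeAll, observe, Prod.mk.injEq, funext_iff, true_and, forall_and]
    tauto
  · intro t t' v v' h
    simp only [Prod.mk.injEq] at h
    exact Prod.ext h.2.1 h.2.2.1
  · filter_upwards [ae_all_iff.2 (hf θ)] with ω hω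
    simp only [hω]
    rfl

/-- The mean of the answer entropies for given queries is at most the download cost, because
conditioning on the queries does not increase entropy. -/
theorem integral_answerEntropy_le
    (hf : ∀ θ n, ∀ᵐ ω ∂S.μ, S.A θ n ω = f n (S.Q θ n ω) (S.messages ω)) (θ : Fin K) :
    ENNReal.ofReal (∑ n, ∫ ω, finEntropy S.law (f n (S.Q θ n ω)) ∂S.μ) ≤ S.downloadCost θ := by
  rw [downloadCost, ENNReal.ofReal_sum_of_nonneg fun n _ => integral_nonneg fun _ =>
    finEntropy_nonneg S.isProbVec_law _]
  refine Finset.sum_le_sum fun n _ => ?_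
  have hY : ∀ b, MeasurableSet (S.setup θ ⁻¹' {b}) := fun b =>
    S.measurable_setup θ (measurableSet_singleton b)
  refine le_trans (le_of_eq ?_) (condEntropy_le_entropy (Y := S.setup θ)
    (fun a => S.measurable_A θ n (measurableSet_singleton a)) hY)
  rw [condEntropy_eq_lintegral S.measurable_messages (S.measurable_setup θ)
    (S.indepFun_messages_setup θ) (fun t w => f n (t.2 n) w) (fun t _ => t)
    (fun _ _ _ _ h => h) (hf θ n) (ae_of_all _ fun _ => rfl),
    ofReal_integral_eq_lintegral_ofReal (S.integrable_answerEntropy f θ n)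
    (ae_of_all _ fun _ => finEntropy_nonneg S.isProbVec_law _)]
  refine lintegral_congr fun ω => ?_
  rw [← law, finCondEntropy_const S.isProbVec_law]
  rfl

/-! ### The converse for one scheme -/

variable (f)

/-- By privacy, a single database cannot tell which message is desired. -/
theorem singleEntropy_eq (θ θ' : Fin K) (n : Fin N) (s : Finset (Fin K)) :
    S.singleEntropy f θ n s = S.singleEntropy f θ' n s := by
  have h := (S.privacy n θ θ').comp (u := fun x =>
    finCondEntropy S.law (observe f n x.2.2.2 x.1) (restrictMsg s)) .of_discrete
  exact h.integral_eq

/-- The interference: the user decodes message `θ` from the observation, so that the observation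
contains the `L` bits of `W_θ` and, beyond these, its entropy given `W_θ`. -/
theorem message_add_jointEntropy_insert_le {θ : Fin K} {s : Finset (Fin K)} (hθ : θ ∉ s) :
    S.L + S.jointEntropy f θ (insert θ s) ≤ S.jointEntropy f θ s + S.residualReal f θ := by
  have hp := S.isProbVec_law
  have key : ∀ ω, S.L + finCondEntropy S.law (S.observeAll f (S.setup θ ω))
      (restrictMsg (insert θ s)) ≤ finCondEntropy S.law (S.observeAll f (S.setup θ ω))
      (restrictMsg s) + finCondEntropy S.law (fun w => w θ) (S.observeAll f (S.setup θ ω)) := by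
    intro ω
    set X := S.observeAll f (S.setup θ ω)
    have h1 := finEntropy_submodular hp (restrictMsg s) (fun w => w θ) X
    have h2 := S.finEntropy_restrictMsg_insert hθ
    have h3 : finEntropy S.law (fun w => (X w, restrictMsg (insert θ s) w))
        ≤ finEntropy S.law (fun w => (restrictMsg s w, w θ, X w)) := by
      refine finEntropy_le_of_factor hp fun v w h => ?_
      simp only [Prod.mk.injEq] at h ⊢
      refine ⟨h.2.2, funext fun ⟨k, hk⟩ => ?_⟩
      rcases Finset.mem_insert.1 hk with rfl | hk
      · exact h.2.1
      · exact congrFun h.1 ⟨k, hk⟩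
    have h4 : finEntropy S.law (fun w => (restrictMsg s w, X w))
        = finEntropy S.law (fun w => (X w, restrictMsg s w)) :=
      finEntropy_congr hp fun v w => by simp [and_comm]
    simp only [finCondEntropy]
    linarith
  have h := integral_mono (((integrable_const (S.L : ℝ)).add
    (S.integrable_jointEntropy f θ (insert θ s))))
    ((S.integrable_jointEntropy f θ s).add (S.integrable_residualReal f θ)) key
  rw [integral_add' (integrable_const _) (S.integrable_jointEntropy f θ _),
    integral_add' (S.integrable_jointEntropy f θ s) (S.integrable_residualReal f θ),
    integral_const, probReal_univ, one_smul] at h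
  exact h

theorem jointEntropy_le_sum_singleEntropy (θ : Fin K) (s : Finset (Fin K)) :
    S.jointEntropy f θ s ≤ ∑ n, S.singleEntropy f θ n s := by
  simp only [singleEntropy]
  rw [← integral_finsetSum _ fun n _ => S.integrable_singleEntropy f θ n s]
  exact integral_mono (S.integrable_jointEntropy f θ s)
    (integrable_finsetSum _ fun n _ => S.integrable_singleEntropy f θ n s)
    fun ω => finCondEntropy_pi_le S.isProbVec_law _ _

theorem singleEntropy_le_jointEntropy (θ : Fin K) (n : Fin N) (s : Finset (Fin K)) :
    S.singleEntropy f θ n s ≤ S.jointEntropy f θ s := by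
  refine integral_mono (S.integrable_singleEntropy f θ n s) (S.integrable_jointEntropy f θ s)
    fun ω => ?_
  have h : ∀ v w, S.observeAll f (S.setup θ ω) v = S.observeAll f (S.setup θ ω) w →
      observe f n (S.cached n ω) (S.Q θ n ω) v = observe f n (S.cached n ω) (S.Q θ n ω) w :=
    fun v w h => congrFun h n
  exact finCondEntropy_mono S.isProbVec_law h _

/-- Changing the desired message costs at most a factor `N`, through the marginals that the single
databases see. -/
theorem jointEntropy_le_mul (θ θ' : Fin K) (s : Finset (Fin K)) :
    S.jointEntropy f θ' s ≤ N * S.jointEntropy f θ s := by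
  calc S.jointEntropy f θ' s ≤ ∑ n, S.singleEntropy f θ' n s :=
        S.jointEntropy_le_sum_singleEntropy f θ' s
    _ ≤ ∑ _n : Fin N, S.jointEntropy f θ s := Finset.sum_le_sum fun n _ => by
        rw [S.singleEntropy_eq f θ' θ]
        exact S.singleEntropy_le_jointEntropy f θ n s
    _ = N * S.jointEntropy f θ s := by simp

/-- The answers and the cached bits contribute separately; the cache contributes at most
`c` bits for each database and each message outside `s`. -/
theorem jointEntropy_le_download (θ : Fin K) (s : Finset (Fin K)) :
    S.jointEntropy f θ s ≤ (∑ n, ∫ ω, finEntropy S.law (f n (S.Q θ n ω)) ∂S.μ)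
      + ((K : ℝ) - s.card) * (N * S.c) := by
  refine (S.jointEntropy_le_sum_singleEntropy f θ s).trans ?_
  have h : ∀ n, S.singleEntropy f θ n s
      ≤ (∫ ω, finEntropy S.law (f n (S.Q θ n ω)) ∂S.μ) + ((K : ℝ) - s.card) * S.c := by
    intro n
    have h1 := integral_mono (S.integrable_singleEntropy f θ n s)
      ((S.integrable_answerEntropy f θ n).add (integrable_const (((K : ℝ) - s.card) * S.c)))
      fun ω => (finCondEntropy_pair_le S.isProbVec_law (f n (S.Q θ n ω))
        (cacheContent (S.cached n ω)) (restrictMsg s)).trans (add_le_add_right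
        (finCondEntropy_cacheContent_le S.isProbVec_law (S.card_cached n ω) s) _)
    rwa [integral_add' (S.integrable_answerEntropy f θ n) (integrable_const _),
      integral_const, probReal_univ, one_smul] at h1
  refine (Finset.sum_le_sum fun n _ => h n).trans (le_of_eq ?_)
  rw [Finset.sum_add_distrib]
  simp
  ring

/-- If all messages but `m + 1` are known, the joint entropy is at least
`L (1 + 1/N + ⋯ + 1/N ^ m)`, up to the decoding error. -/
theorem geometric_le_jointEntropy (hN : 1 ≤ N) (m : ℕ) :
    ∀ (s : Finset (Fin K)) (θ : Fin K), θ ∉ s → s.card + (m + 1) = K →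
      S.L * ∑ j ∈ Finset.range (m + 1), 1 / (N : ℝ) ^ j
        ≤ S.jointEntropy f θ s + (m + 1) * ∑ θ', S.residualReal f θ' := by
  have hN' : (1 : ℝ) ≤ N := by exact_mod_cast hN
  have hR : ∀ θ, S.residualReal f θ ≤ ∑ θ', S.residualReal f θ' := fun θ =>
    Finset.single_le_sum (f := S.residualReal f) (fun θ' _ => S.residualReal_nonneg f θ')
      (Finset.mem_univ θ)
  have hR0 : 0 ≤ ∑ θ', S.residualReal f θ' :=
    Finset.sum_nonneg fun θ' _ => S.residualReal_nonneg f θ'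
  induction m with
  | zero =>
    intro s θ hθ _
    have h1 := S.message_add_jointEntropy_insert_le f hθ
    have h2 := S.jointEntropy_nonneg f θ (insert θ s)
    have h3 := hR θ
    simp
    linarith
  | succ m ih =>
    intro s θ hθ hs
    have hcard : (insert θ s).card + (m + 1) = K := by
      rw [Finset.card_insert_of_notMem hθ]
      omega
    obtain ⟨θ', hθ'⟩ : ∃ θ', θ' ∉ insert θ s := by
      by_contra! hall
      have : insert θ s = Finset.univ := Finset.eq_univ_iff_forall.2 hall
      rw [this, Finset.card_univ, Fintype.card_fin] at hcard
      omega
    have h1 := S.message_add_jointEntropy_insert_le f hθ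
    have h2 := S.jointEntropy_le_mul f θ θ' (insert θ s)
    have h3 := ih (insert θ s) θ' hθ' hcard
    have h4 := hR θ
    -- Decode `θ`, then pass to the undecoded message `θ'` at the cost of a factor `N`.
    set R := ∑ θ', S.residualReal f θ'
    set G := ∑ j ∈ Finset.range (m + 1), 1 / (N : ℝ) ^ j with hG
    have h5 : ∑ j ∈ Finset.range (m + 1 + 1), 1 / (N : ℝ) ^ j = 1 + G / N := by
      rw [Finset.sum_range_succ', hG, Finset.sum_div, add_comm]
      simp [pow_succ, div_eq_mul_inv, mul_comm]
    have h6 : S.L * G / N ≤ S.jointEntropy f θ (insert θ s) + (m + 1) * R := by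
      rw [div_le_iff₀ (by linarith)]
      have : (m + 1) * R * 1 ≤ (m + 1) * R * N :=
        mul_le_mul_of_nonneg_left hN' (by positivity)
      linarith
    rw [h5, mul_add, mul_one, ← mul_div_assoc]
    push_cast
    linarith

variable {f}

theorem geometric_le_downloadCost (hN : 1 ≤ N) (m : ℕ) (s : Finset (Fin K)) (θ : Fin K)
    (hθ : θ ∉ s) (hs : s.card + (m + 1) = K) :
    ENNReal.ofReal (S.L * ∑ j ∈ Finset.range (m + 1), 1 / (N : ℝ) ^ j)
      ≤ S.downloadCost θ + ENNReal.ofReal ((m + 1) * (N * S.c : ℕ))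
        + ((m + 1 : ℕ) : ℝ≥0∞) * ∑ θ', S.residual θ' := by
  obtain ⟨f, hf⟩ := S.exists_answer_function θ
  have h1 := S.geometric_le_jointEntropy f hN m s θ hθ hs
  have h2 := S.jointEntropy_le_download f θ s
  have hm : (K : ℝ) - s.card = m + 1 := by
    have : ((s.card + (m + 1) : ℕ) : ℝ) = K := congrArg _ hs
    push_cast at this
    linarith
  rw [hm] at h2
  simp_rw [S.residual_eq hf]
  rw [← ENNReal.ofReal_sum_of_nonneg fun θ' _ => S.residualReal_nonneg f θ',
    ← ENNReal.ofReal_natCast (m + 1), ← ENNReal.ofReal_mul (Nat.cast_nonneg _)]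
  refine le_trans ?_ (add_le_add_left (add_le_add_left (S.integral_answerEntropy_le hf θ) _) _)
  rw [← ENNReal.ofReal_add (Finset.sum_nonneg fun n _ => integral_nonneg fun _ =>
    finEntropy_nonneg S.isProbVec_law _) (by positivity), ← ENNReal.ofReal_add]
  · refine ENNReal.ofReal_le_ofReal ?_
    push_cast
    linarith
  · exact add_nonneg (Finset.sum_nonneg fun n _ => integral_nonneg fun _ =>
      finEntropy_nonneg S.isProbVec_law _) (by positivity)
  · exact mul_nonneg (Nat.cast_nonneg _) (Finset.sum_nonneg fun θ' _ => S.residualReal_nonneg f θ')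

end Scheme

/-! ### Passing to the limit -/

theorem Achievable.geometric_le {K N : ℕ} (hN : 1 ≤ N) {r : ℝ} {d : ℝ≥0∞}
    (h : Achievable K N r d) {m : ℕ} (hm : m + 1 ≤ K) :
    ENNReal.ofReal (∑ j ∈ Finset.range (m + 1), 1 / (N : ℝ) ^ j)
      ≤ d + ENNReal.ofReal ((m + 1) * r) := by
  obtain ⟨S, hL, hc, hres, hD⟩ := h
  obtain ⟨s, -, hs⟩ := Finset.exists_subset_card_eq (s := (Finset.univ : Finset (Fin K)))
    (n := K - (m + 1)) (by simp)
  obtain ⟨θ, hθ⟩ : ∃ θ, θ ∉ s := by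
    by_contra! hall
    rw [Finset.eq_univ_iff_forall.2 hall, Finset.card_univ, Fintype.card_fin] at hs
    omega
  have hlim : Tendsto (fun i => (S i).downloadCost θ / ((S i).L : ℝ≥0∞)
      + ENNReal.ofReal ((m + 1) * (((N * (S i).c : ℕ) : ℝ) / ((S i).L : ℝ)))
      + ((m + 1 : ℕ) : ℝ≥0∞) * ∑ θ', (S i).residual θ' / ((S i).L : ℝ≥0∞)) atTop
      (𝓝 (d + ENNReal.ofReal ((m + 1) * r) + ((m + 1 : ℕ) : ℝ≥0∞) * ∑ _θ' : Fin K, 0)) :=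
    ((hD θ).add (ENNReal.tendsto_ofReal (hc.const_mul _))).add
      (ENNReal.Tendsto.const_mul (tendsto_finsetSum _ fun θ' _ => hres θ')
        (Or.inr (ENNReal.natCast_ne_top _)))
  rw [Finset.sum_const_zero, mul_zero, add_zero] at hlim
  refine ge_of_tendsto hlim ?_
  filter_upwards [hL.eventually_gt_atTop 0] with i hi
  have hi' : (0 : ℝ) < (S i).L := by exact_mod_cast hi
  have h1 := ENNReal.div_le_div_right ((S i).geometric_le_downloadCost hN m s θ hθ (by omega))
    ((S i).L : ℝ≥0∞)
  rw [← ENNReal.ofReal_natCast (S i).L, ← ENNReal.ofReal_div_of_pos hi',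
    mul_div_cancel_left₀ _ hi'.ne'] at h1
  refine h1.trans (le_of_eq ?_)
  rw [ENNReal.add_div, ENNReal.add_div, ← ENNReal.ofReal_div_of_pos hi', mul_div_assoc,
    mul_div_assoc, div_eq_mul_inv (∑ θ', (S i).residual θ'), Finset.sum_mul]
  simp only [div_eq_mul_inv, ENNReal.ofReal_natCast]

/-- The difference of the two forms of the bound for `m` remaining messages vanishes: the
coefficient of `r` telescopes to `m`. -/
theorem inner_bound_eq (m : ℕ) (x r : ℝ) :
    (1 - r) * ∑ j ∈ Finset.range (m + 1), x ^ j
        - r * (1 - x) * ∑ j ∈ Finset.range m, ((m : ℝ) - j) * x ^ j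
      = ∑ j ∈ Finset.range (m + 1), x ^ j - (m + 1) * r := by
  have h : ∑ j ∈ Finset.range (m + 1), x ^ j
      + (1 - x) * ∑ j ∈ Finset.range m, ((m : ℝ) - j) * x ^ j = m + 1 := by
    induction m with
    | zero => simp
    | succ m ih =>
      have e : ∑ j ∈ Finset.range (m + 1), (((m + 1 : ℕ) : ℝ) - j) * x ^ j
          = ∑ j ∈ Finset.range m, ((m : ℝ) - j) * x ^ j + ∑ j ∈ Finset.range (m + 1), x ^ j := by
        have e' : ∑ j ∈ Finset.range m, ((m : ℝ) - j) * x ^ j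
            = ∑ j ∈ Finset.range (m + 1), ((m : ℝ) - j) * x ^ j := by
          rw [Finset.sum_range_succ, sub_self, zero_mul, add_zero]
        rw [e', ← Finset.sum_add_distrib]
        refine Finset.sum_congr rfl fun j _ => ?_
        push_cast
        ring
      have g := mul_neg_geom_sum x (m + 1)
      rw [Finset.sum_range_succ, e]
      push_cast
      linarith
  linear_combination -r * h

end CachePIR

theorem theorem2 (K N : ℕ) (hK : 1 ≤ K) (hN : 1 ≤ N) (r : ℝ) (hr0 : 0 ≤ r) (hr1 : r ≤ 1) :
    (((Finset.Icc 2 (K + 1)).sup' (Finset.nonempty_Icc.mpr (by omega)) fun i : ℕ =>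
        (1 - r) * ∑ j ∈ Finset.range (K + 2 - i), 1 / (N : ℝ) ^ j
          - r * (1 - 1 / (N : ℝ)) *
            ∑ j ∈ Finset.range (K + 1 - i), ((K : ℝ) + 1 - i - j) / (N : ℝ) ^ j : ℝ) : EReal)
      ≤ ((CachePIR.optimalCost K N r : ENNReal) : EReal) ∧
    ((Finset.Icc 2 (K + 1)).sup' (Finset.nonempty_Icc.mpr (by omega)) fun i : ℕ =>
        (1 - r) * ∑ j ∈ Finset.range (K + 2 - i), 1 / (N : ℝ) ^ j
          - r * (1 - 1 / (N : ℝ)) *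
            ∑ j ∈ Finset.range (K + 1 - i), ((K : ℝ) + 1 - i - j) / (N : ℝ) ^ j) =
      (Finset.Icc 2 (K + 1)).sup' (Finset.nonempty_Icc.mpr (by omega)) fun i : ℕ =>
        ∑ j ∈ Finset.range (K + 2 - i), 1 / (N : ℝ) ^ j - ((K : ℝ) + 2 - i) * r := by
  have hform : ∀ i ∈ Finset.Icc 2 (K + 1),
      (1 - r) * ∑ j ∈ Finset.range (K + 2 - i), 1 / (N : ℝ) ^ j
          - r * (1 - 1 / (N : ℝ)) *
            ∑ j ∈ Finset.range (K + 1 - i), ((K : ℝ) + 1 - i - j) / (N : ℝ) ^ j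
        = ∑ j ∈ Finset.range (K + 2 - i), 1 / (N : ℝ) ^ j - ((K : ℝ) + 2 - i) * r := by
    intro i hi
    obtain ⟨m, hm⟩ : ∃ m, K + 1 = m + i := ⟨K + 1 - i, by have := Finset.mem_Icc.1 hi; omega⟩
    have hK' : (K : ℝ) = m + i - 1 := by
      have : ((K + 1 : ℕ) : ℝ) = ((m + i : ℕ) : ℝ) := by rw [hm]
      push_cast at this
      linarith
    have h := CachePIR.inner_bound_eq m (1 / (N : ℝ)) r
    simp only [one_div_pow] at h
    rw [show K + 2 - i = m + 1 by omega, show K + 1 - i = m by omega, hK']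
    convert h using 3
    · refine Finset.sum_congr rfl fun j _ => ?_
      ring
    · ring
  have hsup := Finset.sup'_congr (Finset.nonempty_Icc.mpr (show 2 ≤ K + 1 by omega)) rfl hform
  refine ⟨?_, hsup⟩
  rw [hsup]
  obtain ⟨i, hi, hmax⟩ := Finset.exists_mem_eq_sup' (Finset.nonempty_Icc.mpr
    (show 2 ≤ K + 1 by omega)) fun i : ℕ =>
      ∑ j ∈ Finset.range (K + 2 - i), 1 / (N : ℝ) ^ j - ((K : ℝ) + 2 - i) * r
  rw [hmax]
  obtain ⟨m, hm⟩ : ∃ m, K + 1 = m + i := ⟨K + 1 - i, by have := Finset.mem_Icc.1 hi; omega⟩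
  have hi2 := (Finset.mem_Icc.1 hi).1
  have hK' : (K : ℝ) + 2 - i = m + 1 := by
    have : ((K + 1 : ℕ) : ℝ) = ((m + i : ℕ) : ℝ) := by rw [hm]
    push_cast at this
    linarith
  -- A negative bound is harmless: truncation at `0` only increases it.
  have key : ENNReal.ofReal (∑ j ∈ Finset.range (K + 2 - i), 1 / (N : ℝ) ^ j
      - ((K : ℝ) + 2 - i) * r) ≤ CachePIR.optimalCost K N r := by
    refine le_sInf fun d hd => ?_
    rw [hK', show K + 2 - i = m + 1 by omega, ENNReal.ofReal_sub _ (by positivity)]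
    exact tsub_le_iff_right.2 (CachePIR.Achievable.geometric_le hN hd (by omega))
  calc _ ≤ ((ENNReal.ofReal (∑ j ∈ Finset.range (K + 2 - i), 1 / (N : ℝ) ^ j
      - ((K : ℝ) + 2 - i) * r) : ENNReal) : EReal) := by
        rw [EReal.coe_ennreal_ofReal]
        exact EReal.coe_le_coe_iff.2 (le_max_left _ _)
    _ ≤ _ := EReal.coe_ennreal_le_coe_ennreal_iff.2 key
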